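/- Let $\ell\ge 1$. A lozenge tiling of the regular hexagon with side length $\ell$ (two sides vertical) is represented in the usual way by a family $h=(h_i)_{0\le i<\ell}$ of $\ell$ nonintersecting lattice paths: $h_i:\{-\ell,\dots,\ell\}\to\tfrac12\mathbb Z$, $h_i(\pm\ell)=i$, $|h_i(x+1)-h_i(x)|=\tfrac12$, and $h_i(x)<h_j(x)$ for $i<j$. The Luby–Randall–Sinclair chain on these families makes the following step. Choose one of the $\ell(2\ell-1)$ internal path points $(i,x)$, $-\ell<x<\ell$, uniformly at random and, independently, a direction (up or down) with probability $\tfrac12$ each. If path $i$ has at $x$ a local minimum and the direction is up (a local maximum and the direction is down), let $k$ be the number of paths blocking the move, i.e. the paths directly above (below) path $i$ that are stacked onto it at consecutive heights $h_i(x)\pm1,\dots,h_i(x)\pm k$ in column $x$; with probability $1/(k+1)$ the points in column $x$ of path $i$ and of these $k$ paths are all moved by one unit in the chosen direction, and otherwise nothing changes. In all other cases nothing changes. Let $P_\ell$ be the transition matrix, let $\mu_\ell$ be the stationary distribution (the uniform distribution on the state space), and put $$\bar d_\ell(t)=\max_{x,y}\|P_\ell^t(x,\cdot)-P_\ell^t(y,\cdot)\|_{\mathrm{TV}},\qquad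 d_\ell(t)=\max_x\|P_\ell^t(x,\cdot)-\mu_\ell\|_{\mathrm{TV}}.$$ Theorem (hexagon lower bound, unlabeled). For every fixed $\varepsilon\in(0,1)$, the mixing time $\min\{t\ge 0:\bar d_\ell(t)<\varepsilon\}$ (for instance with $\varepsilon=1/e$) is at least $$\Bigl(\frac{8}{\pi^2}-o(1)\Bigr)\,\ell^4\log\ell ,$$ where $o(1)\to 0$ as $\ell\to\infty$ for fixed $\varepsilon$; and the same lower bound holds for $\min\{t\ge 0: d_\ell(t)<\varepsilon\}$. -/

import Mathlib

open Filter Topology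

noncomputable section

namespace LRS

/-- Lozenge tilings of the regular hexagon of side `ℓ` (with two vertical sides), in their
lattice path representation: `ℓ` paths, the `i`-th one running from the `i`-th unit edge of the left
vertical side (column `-ℓ`) to the `i`-th unit edge of the right vertical side (column `ℓ`).
`h i x` is twice the height of path `i` in column `x`: steps `±1/2` of the paths become `±1`,
a local push by `1` becomes `±2`, and consecutive starting points differ by `2`.
The paths are extended by their constant end height to the columns outside the hexagon. -/
structure IsRouting (ℓ : ℕ) (h : Fin ℓ → ℤ → ℤ) : Prop where
  pinned : ∀ i x, (x ≤ -(ℓ : ℤ) ∨ (ℓ : ℤ) ≤ x) → h i x = 2 * (i : ℤ)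
  step : ∀ i x, -(ℓ : ℤ) ≤ x → x < ℓ → |h i (x + 1) - h i x| = 1
  nonintersecting : ∀ i j, i < j → ∀ x, h i x < h j x

/-- The state space: families of `ℓ` nonintersecting lattice paths in the hexagon of side `ℓ`. -/
def Routing (ℓ : ℕ) : Type := {h : Fin ℓ → ℤ → ℤ // IsRouting ℓ h}

theorem IsRouting.abs_le {ℓ : ℕ} {h : Fin ℓ → ℤ → ℤ} (H : IsRouting ℓ h) (i : Fin ℓ) (x : ℤ)
    (hx : -(ℓ : ℤ) ≤ x) : |h i x - 2 * (i : ℤ)| ≤ x + ℓ := by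
  induction x, hx using Int.leInduction with
  | base => rw [H.pinned i _ (Or.inl le_rfl)]; simp
  | succ x hx ih =>
    by_cases hl : x < ℓ
    · have := H.step i x hx hl
      rw [_root_.abs_le] at ih ⊢
      have h3 := _root_.abs_le.1 this.le
      constructor <;> linarith [ih.1, ih.2, h3.1, h3.2]
    · rw [H.pinned i (x + 1) (Or.inr (by omega))]
      simp; omega

instance (ℓ : ℕ) : Finite (Routing ℓ) := by
  let F : Routing ℓ → (Fin ℓ → Set.Icc (-(ℓ : ℤ)) ℓ → Set.Icc (-(4 * ℓ : ℤ)) (4 * ℓ)) :=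
    fun h i x => ⟨h.1 i x.1, by
      have := abs_le.1 (h.2.abs_le i x.1 x.2.1)
      have h2 := x.2.2
      have h3 := i.2
      constructor <;> omega⟩
  refine Finite.of_injective F ?_
  intro g h hgh
  apply Subtype.ext
  funext i x
  by_cases hx : -(ℓ : ℤ) ≤ x ∧ x ≤ ℓ
  · have := congrFun (congrFun hgh i) ⟨x, hx⟩
    exact congrArg Subtype.val this
  · rw [g.2.pinned i x (by omega), h.2.pinned i x (by omega)]

instance (ℓ : ℕ) : Fintype (Routing ℓ) := Fintype.ofFinite _

instance (ℓ : ℕ) : DecidableEq (Routing ℓ) := Classical.decEq _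

/-- The tower of paths that moves in column `x` when path `i` is pushed in direction `s`
(`s = 1` up, `s = -1` down): path `i` itself together with the paths that block it, i.e. the paths
above (below) it that are stacked onto it without a gap in that column.  (As distinct paths are at
least `2` apart in every column, such paths are consecutive.)  Its cardinality is `k + 1`,
where `k` is the number of blocking paths. -/
def tower {ℓ : ℕ} (h : Fin ℓ → ℤ → ℤ) (i : Fin ℓ) (x s : ℤ) : Finset (Fin ℓ) :=
  Finset.univ.filter fun j => 0 ≤ s * ((j : ℤ) - (i : ℤ)) ∧ h j x - h i x = 2 * ((j : ℤ) - (i : ℤ))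

/-- Heights after the whole tower has been moved one unit (`2` in doubled heights). -/
def shift {ℓ : ℕ} (h : Fin ℓ → ℤ → ℤ) (i : Fin ℓ) (x s : ℤ) : Fin ℓ → ℤ → ℤ :=
  fun j y => if y = x ∧ j ∈ tower h i x s then h j y + 2 * s else h j y

open Classical in
/-- The result of a tower move: if moving the tower gives an invalid configuration (which is the
case when path `i` has no local extremum at `x` pointing in the direction opposite to `s`),
the configuration does not change. -/
def push {ℓ : ℕ} (h : Routing ℓ) (i : Fin ℓ) (x s : ℤ) : Routing ℓ :=
  if H : IsRouting ℓ (shift h.1 i x s) then ⟨shift h.1 i x s, H⟩ else h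

/-- Transition matrix of the Luby–Randall–Sinclair chain: pick one of the `ℓ (2ℓ - 1)` internal
points of the paths uniformly, pick a direction with probability `1/2` each, and carry out the
tower move with probability `1/(k+1)`, where `k` is the number of blocking paths. -/
def P (ℓ : ℕ) : Matrix (Routing ℓ) (Routing ℓ) ℝ := fun h h' =>
  ∑ i : Fin ℓ, ∑ x ∈ Finset.Ioo (-(ℓ : ℤ)) ℓ, ∑ s ∈ ({1, -1} : Finset ℤ),
    1 / ((ℓ : ℝ) * (2 * ℓ - 1)) * (1 / 2) *
      (1 / ((tower h.1 i x s).card : ℝ) * (if push h i x s = h' then 1 else 0) +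
        (1 - 1 / ((tower h.1 i x s).card : ℝ)) * (if h = h' then 1 else 0))

/-- Total variation distance of two distributions on a finite set. -/
def tv {X : Type*} [Fintype X] (p q : X → ℝ) : ℝ := 1 / 2 * ∑ y, |p y - q y|

/-- Worst-case variation distance at time `t` from the stationary (uniform) distribution. -/
def d (ℓ t : ℕ) : ℝ :=
  ⨆ g : Routing ℓ, tv ((P ℓ ^ t) g) (fun _ => 1 / (Fintype.card (Routing ℓ) : ℝ))

/-- Largest variation distance at time `t` between the chains started in two states. -/
def dbar (ℓ t : ℕ) : ℝ :=
  ⨆ g : Routing ℓ × Routing ℓ, tv ((P ℓ ^ t) g.1) ((P ℓ ^ t) g.2)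

/-- The first time at which the distance function `f` is less than `ε` (`⊤` if there is none). -/
def firstTimeBelow (f : ℕ → ℝ) (ε : ℝ) : ℕ∞ := ⨅ (t : ℕ) (_ : f t < ε), (t : ℕ∞)

/-- The (variation) mixing time at level `ε`; the usual choice is `ε = 1/e`. -/
def mixingTime (ℓ : ℕ) (ε : ℝ) : ℕ∞ := firstTimeBelow (dbar ℓ) ε

end LRS

end

namespace LRS

/-! The proof is Wilson's second-moment method. A tower of k + 1 points moves with probability 1/(k
+ 1), so the expected total displacement of a column does not feel the blocking: on average each
path evolves by the discrete heat equation with pinned ends. Hence `displacement`, which weights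
column x by cos(πx/2ℓ), is an exact eigenfunction with eigenvalue 1 - γ, where γ = `gap ℓ` ~
π²/(16ℓ⁴) (`P_mulVec_displacement`).

From the highest configuration this statistic starts at order ℓ³ (`le_displacement_top`). One step
adds at most 4ℓ to its second moment beyond the contraction (`sum_P_displacement_sq_le`), so its
variance stays O(ℓ/γ) = O(ℓ⁵), at all times and in equilibrium. As long as the squared mean (1 -
γ)^(2t) ℓ⁶ dominates ℓ⁵, the law at time t is nearly disjoint from the uniform one
(`one_sub_le_tv_uniform`). That lasts until t ≈ (log ℓ)/(2γ) ~ (8/π²) ℓ⁴ log ℓ.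

Uniform equilibrium comes from the symmetry of the transition matrix (`P_symm`), and the bound for
`d` passes to `dbar` by convexity (`d_le_dbar`). -/

variable {ℓ : ℕ}

/-! ### Parity and vertical separation of the paths. -/

theorem IsRouting.parity {h : Fin ℓ → ℤ → ℤ} (H : IsRouting ℓ h) (i : Fin ℓ) (x : ℤ)
    (hx : -(ℓ : ℤ) ≤ x) (hx' : x ≤ ℓ) : ∃ m : ℤ, h i x = x + ℓ + 2 * m := by
  induction x, hx using Int.leInduction with
  | base => exact ⟨i, by rw [H.pinned i _ (Or.inl le_rfl)]; ring⟩
  | succ x hx ih =>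
    obtain ⟨m, hm⟩ := ih (by omega)
    rcases (abs_eq (by norm_num : (0 : ℤ) ≤ 1)).1 (H.step i x hx (by omega)) with h1 | h1
    · exact ⟨m, by omega⟩
    · exact ⟨m - 1, by omega⟩

theorem IsRouting.even_sub {h : Fin ℓ → ℤ → ℤ} (H : IsRouting ℓ h) (i j : Fin ℓ) (x : ℤ)
    (hx : -(ℓ : ℤ) ≤ x) (hx' : x ≤ ℓ) : ∃ m : ℤ, h j x - h i x = 2 * m := by
  obtain ⟨a, ha⟩ := H.parity i x hx hx'
  obtain ⟨b, hb⟩ := H.parity j x hx hx'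
  exact ⟨b - a, by omega⟩

/-- Gaps in one column are even, so strict ordering already forces a gap of 2 between consecutive
paths. -/
theorem IsRouting.separated {h : Fin ℓ → ℤ → ℤ} (H : IsRouting ℓ h) {x : ℤ}
    (hx : -(ℓ : ℤ) ≤ x) (hx' : x ≤ ℓ) {i j : Fin ℓ} (hij : i ≤ j) :
    2 * ((j : ℤ) - i) ≤ h j x - h i x := by
  obtain ⟨j, hj⟩ := j
  have hij' : (i : ℕ) ≤ j := hij
  clear hij
  induction j, hij' using Nat.le_induction with
  | base => simp
  | succ j hij ih =>
    have h1 := ih (by omega)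
    have h2 := H.nonintersecting ⟨j, by omega⟩ ⟨j + 1, hj⟩ (by simp [Fin.lt_def]) x
    obtain ⟨m, hm⟩ := H.even_sub ⟨j, by omega⟩ ⟨j + 1, hj⟩ x hx hx'
    simp only at h1 h2 hm ⊢
    push_cast
    omega

/-- Vertical separation of the paths, in both directions at once. -/
theorem IsRouting.separated_sign {h : Fin ℓ → ℤ → ℤ} (H : IsRouting ℓ h) {x : ℤ}
    (hx : -(ℓ : ℤ) ≤ x) (hx' : x ≤ ℓ) {s : ℤ} (hs : s = 1 ∨ s = -1) {i j : Fin ℓ}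
    (hij : 0 ≤ s * ((j : ℤ) - i)) : 2 * (s * ((j : ℤ) - i)) ≤ s * (h j x - h i x) := by
  rcases hs with rfl | rfl
  · have := H.separated hx hx' (i := i) (j := j) (by rw [Fin.le_def]; omega)
    omega
  · have := H.separated hx hx' (i := j) (j := i) (by rw [Fin.le_def]; omega)
    omega

/-! ### Tower moves: when they are legal, and how they are undone. -/

theorem mem_tower {h : Fin ℓ → ℤ → ℤ} {i j : Fin ℓ} {x s : ℤ} :
    j ∈ tower h i x s ↔ 0 ≤ s * ((j : ℤ) - (i : ℤ)) ∧ h j x - h i x = 2 * ((j : ℤ) - (i : ℤ)) := by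
  simp [tower]

theorem self_mem_tower (h : Fin ℓ → ℤ → ℤ) (i : Fin ℓ) (x s : ℤ) : i ∈ tower h i x s := by
  simp [mem_tower]

theorem card_tower_pos (h : Fin ℓ → ℤ → ℤ) (i : Fin ℓ) (x s : ℤ) :
    0 < (tower h i x s).card :=
  Finset.card_pos.2 ⟨i, self_mem_tower h i x s⟩

theorem card_tower_le (h : Fin ℓ → ℤ → ℤ) (i : Fin ℓ) (x s : ℤ) :
    (tower h i x s).card ≤ ℓ := by
  simpa using Finset.card_le_univ (tower h i x s)

/-- By parity, a path beyond the tower leaves at least one free slot, so a shift by 2 keeps the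
strict order. -/
theorem IsRouting.gap_of_notMem_tower {h : Fin ℓ → ℤ → ℤ} (H : IsRouting ℓ h) {x : ℤ}
    (hx : -(ℓ : ℤ) ≤ x) (hx' : x ≤ ℓ) {s : ℤ} (hs : s = 1 ∨ s = -1) {i j k : Fin ℓ}
    (hj : j ∈ tower h i x s) (hk : k ∉ tower h i x s) (hjk : 0 ≤ s * ((k : ℤ) - j)) :
    2 < s * (h k x - h j x) := by
  rw [mem_tower] at hj hk
  obtain ⟨hj1, hj2⟩ := hj
  have hne : k ≠ j := by rintro rfl; exact hk ⟨hj1, hj2⟩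
  have hne' : (k : ℤ) ≠ j := by simpa [Fin.ext_iff] using hne
  have hki : 0 ≤ s * ((k : ℤ) - i) := by rcases hs with rfl | rfl <;> omega
  have h1 := H.separated_sign hx hx' hs hki
  have h2 : h k x - h i x ≠ 2 * ((k : ℤ) - i) := fun h' => hk ⟨hki, h'⟩
  obtain ⟨m, hm⟩ := H.even_sub i k x hx hx'
  rcases hs with rfl | rfl <;> omega

theorem shift_apply_of_mem {h : Fin ℓ → ℤ → ℤ} {i j : Fin ℓ} {x s : ℤ}
    (hj : j ∈ tower h i x s) : shift h i x s j x = h j x + 2 * s := by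
  simp [shift, hj]

theorem shift_apply_of_notMem {h : Fin ℓ → ℤ → ℤ} {i j : Fin ℓ} {x s : ℤ}
    (hj : j ∉ tower h i x s) (y : ℤ) : shift h i x s j y = h j y := by
  simp [shift, hj]

theorem shift_apply_of_ne {h : Fin ℓ → ℤ → ℤ} {i j : Fin ℓ} {x y s : ℤ}
    (hy : y ≠ x) : shift h i x s j y = h j y := by
  simp [shift, hy]

/-- A tower move is possible precisely when its first path has a local extremum
of the right kind. -/
theorem IsRouting.shift_iff {h : Fin ℓ → ℤ → ℤ} (H : IsRouting ℓ h) {i : Fin ℓ} {x s : ℤ}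
    (hx : -(ℓ : ℤ) < x) (hx' : x < ℓ) (hs : s = 1 ∨ s = -1) :
    IsRouting ℓ (shift h i x s) ↔ h i (x + 1) = h i x + s ∧ h i (x - 1) = h i x + s := by
  constructor
  · intro K
    have a1 := H.step i x hx.le hx'
    have a2 := H.step i (x - 1) (by omega) (by omega)
    have b1 := K.step i x hx.le hx'
    have b2 := K.step i (x - 1) (by omega) (by omega)
    rw [sub_add_cancel] at a2 b2
    rw [shift_apply_of_mem (self_mem_tower h i x s), shift_apply_of_ne (by omega)] at b1 b2
    rw [abs_eq zero_le_one] at a1 a2 b1 b2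
    rcases hs with rfl | rfl <;> omega
  · rintro ⟨e1, e2⟩
    -- The extremum propagates through the tower: in the neighbouring columns separation from path i
    -- pushes path j at least one step in direction s, and a step has length exactly 1.
    have key : ∀ j ∈ tower h i x s, h j (x + 1) = h j x + s ∧ h j (x - 1) = h j x + s := by
      intro j hj
      rw [mem_tower] at hj
      have c1 := H.separated_sign (x := x + 1) (by omega) (by omega) hs hj.1
      have c2 := H.separated_sign (x := x - 1) (by omega) (by omega) hs hj.1
      have a1 := H.step j x hx.le hx'
      have a2 := H.step j (x - 1) (by omega) (by omega)
      rw [sub_add_cancel] at a2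
      rw [abs_eq zero_le_one] at a1 a2
      rcases hs with rfl | rfl <;> omega
    refine ⟨fun j y hy => ?_, fun j y hy hy' => ?_, fun j k hjk y => ?_⟩
    · rw [shift_apply_of_ne (by omega), H.pinned j y hy]
    · by_cases hj : j ∈ tower h i x s
      · obtain ⟨k1, k2⟩ := key j hj
        by_cases h1 : y = x
        · subst h1
          rw [shift_apply_of_mem hj, shift_apply_of_ne (by omega), k1]
          rcases hs with rfl | rfl <;> ring_nf <;> norm_num
        · by_cases h2 : y + 1 = x
          · obtain rfl : y = x - 1 := by omega
            rw [sub_add_cancel, shift_apply_of_mem hj, shift_apply_of_ne (by omega), k2]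
            rcases hs with rfl | rfl <;> ring_nf <;> norm_num
          · rw [shift_apply_of_ne h1, shift_apply_of_ne h2, H.step j y hy hy']
      · rw [shift_apply_of_notMem hj, shift_apply_of_notMem hj, H.step j y hy hy']
    · have hlt := H.nonintersecting j k hjk y
      by_cases hy : y = x
      · subst hy
        have hjk' : (j : ℤ) < k := by exact_mod_cast hjk
        by_cases hj : j ∈ tower h i y s <;> by_cases hk : k ∈ tower h i y s
        · rw [shift_apply_of_mem hj, shift_apply_of_mem hk]; omega
        · rw [shift_apply_of_mem hj, shift_apply_of_notMem hk]
          rcases hs with rfl | rfl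
          · have := H.gap_of_notMem_tower hx.le hx'.le (Or.inl rfl) hj hk (by omega)
            omega
          · omega
        · rw [shift_apply_of_notMem hj, shift_apply_of_mem hk]
          rcases hs with rfl | rfl
          · omega
          · have := H.gap_of_notMem_tower hx.le hx'.le (Or.inr rfl) hk hj (by omega)
            omega
        · rw [shift_apply_of_notMem hj, shift_apply_of_notMem hk]; exact hlt
      · rw [shift_apply_of_ne hy, shift_apply_of_ne hy]; exact hlt

theorem exists_last_mem_tower (h : Fin ℓ → ℤ → ℤ) (i : Fin ℓ) (x s : ℤ) :
    ∃ e ∈ tower h i x s, ∀ j ∈ tower h i x s, 0 ≤ s * ((e : ℤ) - j) := by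
  obtain ⟨e, he, hmax⟩ := (tower h i x s).exists_max_image (fun j => s * (j : ℤ))
    ⟨i, self_mem_tower h i x s⟩
  exact ⟨e, he, fun j hj => by rw [mul_sub]; exact sub_nonneg.2 (hmax j hj)⟩

/-- A tower move is reversed by the move of the same tower from its other end. -/
theorem IsRouting.tower_shift {h : Fin ℓ → ℤ → ℤ} (H : IsRouting ℓ h) {i e : Fin ℓ} {x s : ℤ}
    (hx : -(ℓ : ℤ) ≤ x) (hx' : x ≤ ℓ) (hs : s = 1 ∨ s = -1) (he : e ∈ tower h i x s)
    (hmax : ∀ j ∈ tower h i x s, 0 ≤ s * ((e : ℤ) - j)) :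
    tower (shift h i x s) e x (-s) = tower h i x s := by
  ext j
  by_cases hj : j ∈ tower h i x s
  · have h1 := hmax j hj
    simp only [hj, iff_true]
    rw [mem_tower, shift_apply_of_mem hj, shift_apply_of_mem he]
    rw [mem_tower] at hj he
    rcases hs with rfl | rfl <;> omega
  · simp only [hj, iff_false]
    intro hj'
    rw [mem_tower, shift_apply_of_mem he, shift_apply_of_notMem hj] at hj'
    have he' := (mem_tower.1 he)
    -- A path outside the tower that is stacked behind `e` after the move would have been closer to
    -- `e` by 2 before it, violating the minimal separation.
    have h1 := H.separated_sign hx hx' hs (i := j) (j := e)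
      (by rcases hs with rfl | rfl <;> omega)
    rcases hs with rfl | rfl
    · by_cases hij : 0 ≤ (1 : ℤ) * ((j : ℤ) - i)
      · omega
      · have := H.separated_sign hx hx' (Or.inl rfl) (i := j) (j := i) (by omega)
        omega
    · by_cases hij : 0 ≤ (-1 : ℤ) * ((j : ℤ) - i)
      · omega
      · have := H.separated_sign hx hx' (Or.inr rfl) (i := j) (j := i) (by omega)
        omega

theorem shift_shift {h : Fin ℓ → ℤ → ℤ} {i e : Fin ℓ} {x s : ℤ}
    (ht : tower (shift h i x s) e x (-s) = tower h i x s) :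
    shift (shift h i x s) e x (-s) = h := by
  funext j y
  by_cases hy : y = x
  · subst hy
    by_cases hj : j ∈ tower h i y s
    · rw [shift_apply_of_mem (ht ▸ hj), shift_apply_of_mem hj]; ring
    · rw [shift_apply_of_notMem (ht ▸ hj), shift_apply_of_notMem hj]
  · rw [shift_apply_of_ne hy, shift_apply_of_ne hy]

/-! ### Symmetry of the transition matrix. -/

theorem push_of_isRouting {h : Routing ℓ} {i : Fin ℓ} {x s : ℤ}
    (H : IsRouting ℓ (shift h.1 i x s)) : push h i x s = ⟨shift h.1 i x s, H⟩ :=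
  dif_pos H

theorem push_of_not_isRouting {h : Routing ℓ} {i : Fin ℓ} {x s : ℤ}
    (H : ¬ IsRouting ℓ (shift h.1 i x s)) : push h i x s = h :=
  dif_neg H

theorem push_val_of_ne {h : Routing ℓ} {i : Fin ℓ} {x s : ℤ} (hne : push h i x s ≠ h) :
    (push h i x s).1 = shift h.1 i x s := by
  by_cases H : IsRouting ℓ (shift h.1 i x s)
  · rw [push_of_isRouting H]
  · exact absurd (push_of_not_isRouting H) hne

/-- The moves: a path, a column, and a direction. -/
noncomputable def moves (ℓ : ℕ) : Finset (Fin ℓ × ℤ × ℤ) :=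
  Finset.univ ×ˢ (Finset.Ioo (-(ℓ : ℤ)) ℓ ×ˢ ({1, -1} : Finset ℤ))

theorem mem_moves {m : Fin ℓ × ℤ × ℤ} :
    m ∈ moves ℓ ↔ (-(ℓ : ℤ) < m.2.1 ∧ m.2.1 < ℓ) ∧ (m.2.2 = 1 ∨ m.2.2 = -1) := by
  simp [moves]

/-- The rate at which the move `m` leads from `h` to `g`. -/
noncomputable def rate (h g : Routing ℓ) (m : Fin ℓ × ℤ × ℤ) : ℝ :=
  1 / ((tower h.1 m.1 m.2.1 m.2.2).card : ℝ) * (if push h m.1 m.2.1 m.2.2 = g then 1 else 0) +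
    (1 - 1 / ((tower h.1 m.1 m.2.1 m.2.2).card : ℝ)) * (if h = g then 1 else 0)

theorem P_apply (h g : Routing ℓ) :
    P ℓ h g = 1 / ((ℓ : ℝ) * (2 * ℓ - 1)) * (1 / 2) * ∑ m ∈ moves ℓ, rate h g m := by
  simp only [P, moves, rate, Finset.sum_product, Finset.mul_sum]

/-- Each move from h to g is matched injectively with the reverse push of the same tower from its
far end. The tower sizes agree, hence so do the rates. Exchanging h and g gives equality. -/
theorem sum_rate_le {h g : Routing ℓ} (hne : h ≠ g) :
    ∑ m ∈ moves ℓ, rate h g m ≤ ∑ m ∈ moves ℓ, rate g h m := by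
  classical
  have e1 : ∀ a b : Routing ℓ, a ≠ b → ∑ m ∈ moves ℓ, rate a b m =
      ∑ m ∈ (moves ℓ).filter (fun m => push a m.1 m.2.1 m.2.2 = b),
        1 / ((tower a.1 m.1 m.2.1 m.2.2).card : ℝ) := by
    intro a b hab
    rw [Finset.sum_filter]
    refine Finset.sum_congr rfl fun m _ => ?_
    simp [rate, hab]
  rw [e1 h g hne, e1 g h hne.symm]
  choose e he hmax using fun m : Fin ℓ × ℤ × ℤ => exists_last_mem_tower h.1 m.1 m.2.1 m.2.2
  let F : Fin ℓ × ℤ × ℤ → Fin ℓ × ℤ × ℤ := fun m => (e m, m.2.1, -m.2.2)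
  have key : ∀ m ∈ (moves ℓ).filter (fun m => push h m.1 m.2.1 m.2.2 = g),
      F m ∈ (moves ℓ).filter (fun m => push g m.1 m.2.1 m.2.2 = h) ∧
      tower g.1 (F m).1 (F m).2.1 (F m).2.2 = tower h.1 m.1 m.2.1 m.2.2 := by
    intro m hm
    rw [Finset.mem_filter, mem_moves] at hm
    obtain ⟨⟨⟨hx, hx'⟩, hs⟩, hp⟩ := hm
    have hg : g.1 = shift h.1 m.1 m.2.1 m.2.2 := by
      rw [← hp, push_val_of_ne (by rw [hp]; exact hne.symm)]
    have ht := h.2.tower_shift hx.le hx'.le hs (he m) (hmax m)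
    refine ⟨?_, by simp only [F]; rw [hg, ht]⟩
    rw [Finset.mem_filter, mem_moves]
    refine ⟨⟨⟨hx, hx'⟩, by simp only [F]; omega⟩, ?_⟩
    have hsh : shift g.1 (e m) m.2.1 (-m.2.2) = h.1 := by rw [hg]; exact shift_shift ht
    have : IsRouting ℓ (shift g.1 (e m) m.2.1 (-m.2.2)) := by rw [hsh]; exact h.2
    exact (push_of_isRouting this).trans (Subtype.ext hsh)
  -- Moves with the same image share column, direction and tower, and the pushed path is the first
  -- one of its tower in that direction.
  have hinj : Set.InjOn F ((moves ℓ).filter (fun m => push h m.1 m.2.1 m.2.2 = g)) := by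
    intro m hm m' hm' hFF
    have t1 := (key m hm).2
    have t2 := (key m' hm').2
    rw [hFF, t2] at t1
    obtain ⟨hh1, hh2⟩ := Prod.ext_iff.1 hFF
    obtain ⟨hx, hs⟩ := Prod.ext_iff.1 hh2
    simp only [F, neg_inj] at hx hs
    have u1 := mem_tower.1 (t1 ▸ self_mem_tower h.1 m.1 m.2.1 m.2.2)
    have u2 := mem_tower.1 (t1.symm ▸ self_mem_tower h.1 m'.1 m'.2.1 m'.2.2)
    rw [Finset.mem_coe, Finset.mem_filter, mem_moves] at hm hm'
    refine Prod.ext ?_ (Prod.ext hx hs)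
    rw [Fin.ext_iff]
    have v1 := u1.1
    have v2 := u2.1
    rcases hm.1.2 with hc | hc
    · rw [hs.symm.trans hc] at v1; rw [hc] at v2; omega
    · rw [hs.symm.trans hc] at v1; rw [hc] at v2; omega
  calc _ = ∑ m ∈ (moves ℓ).filter (fun m => push h m.1 m.2.1 m.2.2 = g),
        1 / ((tower g.1 (F m).1 (F m).2.1 (F m).2.2).card : ℝ) :=
        Finset.sum_congr rfl fun m hm => by rw [(key m hm).2]
    _ = ∑ m ∈ ((moves ℓ).filter (fun m => push h m.1 m.2.1 m.2.2 = g)).image F,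
        1 / ((tower g.1 m.1 m.2.1 m.2.2).card : ℝ) := by rw [Finset.sum_image hinj]
    _ ≤ _ := by
        refine Finset.sum_le_sum_of_subset_of_nonneg ?_ fun _ _ _ => by positivity
        intro m hm
        obtain ⟨m', hm', rfl⟩ := Finset.mem_image.1 hm
        exact (key m' hm').1

theorem P_symm (h g : Routing ℓ) : P ℓ h g = P ℓ g h := by
  by_cases hne : h = g
  · rw [hne]
  · rw [P_apply, P_apply, (sum_rate_le hne).antisymm (sum_rate_le (Ne.symm hne))]

open Matrix

/-! ### Wilson's method for a general symmetric finite chain. -/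

section Chain

variable {X : Type*} [Fintype X]

theorem tv_eq_one_sub {p q : X → ℝ} (hp : ∑ y, p y = 1) (hq : ∑ y, q y = 1) :
    tv p q = 1 - ∑ y, min (p y) (q y) := by
  have : ∀ y, |p y - q y| = p y + q y - 2 * min (p y) (q y) := by
    intro y
    rcases le_total (p y) (q y) with h | h
    · rw [min_eq_left h, abs_of_nonpos (by linarith)]; ring
    · rw [min_eq_right h, abs_of_nonneg (by linarith)]; ring
  simp only [tv, this, Finset.sum_sub_distrib, Finset.sum_add_distrib, hp, hq, ← Finset.mul_sum]
  ring

/-- Two distributions that are concentrated around different values of a statistic are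
far apart. -/
theorem one_sub_le_tv {p q Φ : X → ℝ} {m V : ℝ} (hp0 : ∀ y, 0 ≤ p y) (hq0 : ∀ y, 0 ≤ q y)
    (hp : ∑ y, p y = 1) (hq : ∑ y, q y = 1) (hm : m ≠ 0)
    (hpm : ∑ y, p y * (Φ y - m) ^ 2 ≤ V) (hqV : ∑ y, q y * Φ y ^ 2 ≤ V) :
    1 - 4 * V / m ^ 2 ≤ tv p q := by
  rw [tv_eq_one_sub hp hq]
  have hm2 : 0 < m ^ 2 := by positivity
  -- No point is close to both centres: (Φ - m)² + Φ² ≥ m²/2. So the common mass of p and q is paid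
  -- for by the two second moments.
  have key : (∑ y, min (p y) (q y)) * (m ^ 2 / 2) ≤ V + V := by
    refine le_trans ?_ (add_le_add hpm hqV)
    rw [Finset.sum_mul, ← Finset.sum_add_distrib]
    refine Finset.sum_le_sum fun y _ => ?_
    have h0 : 0 ≤ min (p y) (q y) := le_min (hp0 y) (hq0 y)
    calc min (p y) (q y) * (m ^ 2 / 2)
        ≤ min (p y) (q y) * ((Φ y - m) ^ 2 + Φ y ^ 2) := by
          refine mul_le_mul_of_nonneg_left ?_ h0
          nlinarith [sq_nonneg (2 * Φ y - m)]
      _ = min (p y) (q y) * (Φ y - m) ^ 2 + min (p y) (q y) * Φ y ^ 2 := by ring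
      _ ≤ _ := by
          gcongr
          · exact min_le_left _ _
          · exact min_le_right _ _
  have : ∑ y, min (p y) (q y) ≤ 4 * V / m ^ 2 := by
    rw [le_div_iff₀ hm2]; linarith
  linarith

variable [DecidableEq X] {Q : Matrix X X ℝ}

theorem pow_mulVec_eigen {Φ : X → ℝ} {c : ℝ} (h : Q *ᵥ Φ = c • Φ) (t : ℕ) :
    (Q ^ t) *ᵥ Φ = c ^ t • Φ := by
  induction t with
  | zero => simp
  | succ t ih => rw [pow_succ, ← mulVec_mulVec, h, mulVec_smul, ih, smul_smul, pow_succ, mul_comm]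

theorem pow_nonneg_apply (h0 : ∀ x y, 0 ≤ Q x y) (t : ℕ) (x y : X) : 0 ≤ (Q ^ t) x y := by
  induction t generalizing x y with
  | zero => rw [pow_zero, one_apply]; split_ifs <;> norm_num
  | succ t ih =>
    rw [pow_succ, mul_apply]
    exact Finset.sum_nonneg fun z _ => mul_nonneg (ih x z) (h0 z y)

theorem pow_row_sum (h1 : ∀ x, ∑ y, Q x y = 1) (t : ℕ) (x : X) : ∑ y, (Q ^ t) x y = 1 := by
  have : Q *ᵥ (fun _ => (1 : ℝ)) = (1 : ℝ) • (fun _ => (1 : ℝ)) := by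
    ext x; simp [mulVec, dotProduct, h1]
  have := congrFun (pow_mulVec_eigen this t) x
  simpa [mulVec, dotProduct] using this

theorem pow_symm (hs : ∀ x y, Q x y = Q y x) (t : ℕ) (x y : X) : (Q ^ t) x y = (Q ^ t) y x := by
  have h : Qᵀ = Q := by ext x y; exact hs y x
  calc (Q ^ t) x y = (Qᵀ ^ t) x y := by rw [h]
    _ = _ := by rw [← transpose_pow, transpose_apply]

/-- The affine recursion u ↦ (1 - 2γ)u + R contracts to its fixed point R/(2γ). -/
theorem pow_mulVec_sq_le {Φ : X → ℝ} {γ R : ℝ} (h0 : ∀ x y, 0 ≤ Q x y)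
    (h1 : ∀ x, ∑ y, Q x y = 1) (hγ : 0 < γ) (hγ' : 2 * γ ≤ 1)
    (h2 : ∀ x, ∑ y, Q x y * Φ y ^ 2 ≤ (1 - 2 * γ) * Φ x ^ 2 + R) (t : ℕ) (x : X) :
    ∑ y, (Q ^ t) x y * Φ y ^ 2 ≤ (1 - 2 * γ) ^ t * Φ x ^ 2 + (1 - (1 - 2 * γ) ^ t) * (R / (2 * γ)) := by
  induction t with
  | zero => simp [one_apply]
  | succ t ih =>
    calc ∑ y, (Q ^ (t + 1)) x y * Φ y ^ 2 = ∑ z, (Q ^ t) x z * ∑ y, Q z y * Φ y ^ 2 := by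
          simp only [pow_succ, mul_apply, Finset.sum_mul, Finset.mul_sum]
          rw [Finset.sum_comm]
          exact Finset.sum_congr rfl fun _ _ => Finset.sum_congr rfl fun _ _ => by ring
      _ ≤ ∑ z, (Q ^ t) x z * ((1 - 2 * γ) * Φ z ^ 2 + R) :=
          Finset.sum_le_sum fun z _ =>
            mul_le_mul_of_nonneg_left (h2 z) (pow_nonneg_apply h0 t x z)
      _ = (1 - 2 * γ) * ∑ z, (Q ^ t) x z * Φ z ^ 2 + R := by
          simp only [mul_add, Finset.sum_add_distrib, ← Finset.sum_mul, pow_row_sum h1, one_mul,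
            Finset.mul_sum]
          congr 1
          exact Finset.sum_congr rfl fun _ _ => by ring
      _ ≤ (1 - 2 * γ) * ((1 - 2 * γ) ^ t * Φ x ^ 2 + (1 - (1 - 2 * γ) ^ t) * (R / (2 * γ))) + R := by
          gcongr
      _ = _ := by field_simp; ring

/-- Wilson's lower bound for the distance from stationarity of a symmetric chain, from an
eigenfunction with eigenvalue close to `1` and small increments. -/
theorem one_sub_le_tv_uniform {Φ : X → ℝ} {γ R : ℝ} (h0 : ∀ x y, 0 ≤ Q x y)
    (h1 : ∀ x, ∑ y, Q x y = 1) (hs : ∀ x y, Q x y = Q y x) (hγ : 0 < γ) (hγ' : 2 * γ ≤ 1)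
    (hR : 0 ≤ R) (he : Q *ᵥ Φ = (1 - γ) • Φ)
    (h2 : ∀ x, ∑ y, Q x y * Φ y ^ 2 ≤ (1 - 2 * γ) * Φ x ^ 2 + R) (t : ℕ) (x : X)
    (hx : Φ x ≠ 0) :
    1 - 2 * R / (γ * ((1 - γ) ^ t * Φ x) ^ 2) ≤
      tv ((Q ^ t) x) (fun _ => 1 / (Fintype.card X : ℝ)) := by
  have hX : 0 < (Fintype.card X : ℝ) := by exact_mod_cast Fintype.card_pos_iff.2 ⟨x⟩
  have hm : (1 - γ) ^ t * Φ x ≠ 0 := mul_ne_zero (pow_ne_zero _ (by linarith)) hx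
  have hmean : ∑ y, (Q ^ t) x y * Φ y = (1 - γ) ^ t * Φ x := congrFun (pow_mulVec_eigen he t) x
  have hV : 0 ≤ R / (2 * γ) := by positivity
  have hb0 : 0 ≤ (1 - 2 * γ) ^ t := pow_nonneg (by linarith) t
  have hp : ∑ y, (Q ^ t) x y * (Φ y - (1 - γ) ^ t * Φ x) ^ 2 ≤ R / (2 * γ) := by
    have e : ∑ y, (Q ^ t) x y * (Φ y - (1 - γ) ^ t * Φ x) ^ 2 =
        ∑ y, (Q ^ t) x y * Φ y ^ 2 - ((1 - γ) ^ t * Φ x) ^ 2 := by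
      calc _ = ∑ y, ((Q ^ t) x y * Φ y ^ 2 - 2 * ((1 - γ) ^ t * Φ x) * ((Q ^ t) x y * Φ y) +
              ((1 - γ) ^ t * Φ x) ^ 2 * (Q ^ t) x y) := Finset.sum_congr rfl fun _ _ => by ring
        _ = _ := by
          rw [Finset.sum_add_distrib, Finset.sum_sub_distrib, ← Finset.mul_sum, ← Finset.mul_sum,
            hmean, pow_row_sum h1]
          ring
    -- The initial-value term of the second moment is absorbed by the squared mean, leaving a
    -- variance bound uniform in t and x.
    have hb : (1 - 2 * γ) ^ t ≤ ((1 - γ) ^ t) ^ 2 := by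
      rw [← pow_mul, mul_comm t 2, pow_mul]
      exact pow_le_pow_left₀ (by linarith) (by nlinarith) t
    have := pow_mulVec_sq_le h0 h1 hγ hγ' h2 t x
    rw [e]
    nlinarith [mul_le_mul_of_nonneg_right hb (sq_nonneg (Φ x)), mul_nonneg hb0 hV]
  have hq : ∑ y, 1 / (Fintype.card X : ℝ) * Φ y ^ 2 ≤ R / (2 * γ) := by
    rw [← Finset.mul_sum]
    have hcol : ∀ y, ∑ x, Q x y = 1 := fun y => by
      rw [← h1 y]; exact Finset.sum_congr rfl fun x _ => hs x y
    -- Summing the one-step bound over all states, with unit column sums, bounds the equilibrium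
    -- second moment without any limit in t.
    have : ∑ y, Φ y ^ 2 ≤ (1 - 2 * γ) * ∑ y, Φ y ^ 2 + Fintype.card X * R := by
      calc ∑ y, Φ y ^ 2 = ∑ x, ∑ y, Q x y * Φ y ^ 2 := by
            rw [Finset.sum_comm]; simp only [← Finset.sum_mul, hcol, one_mul]
        _ ≤ ∑ x, ((1 - 2 * γ) * Φ x ^ 2 + R) := Finset.sum_le_sum fun x _ => h2 x
        _ = _ := by rw [Finset.sum_add_distrib, ← Finset.mul_sum]; simp
    rw [one_div, inv_mul_le_iff₀ hX, mul_div_assoc', le_div_iff₀ (by positivity)]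
    linarith
  have := one_sub_le_tv (pow_nonneg_apply h0 t x) (fun _ => by positivity) (pow_row_sum h1 t x)
    (by simp [hX.ne']) hm hp hq
  refine le_trans (le_of_eq ?_) this
  field_simp
  ring

/-- For a symmetric chain, the distance of a row from uniform is at most the maximal distance
between rows. -/
theorem tv_uniform_le [Nonempty X] (h1 : ∀ x, ∑ y, Q x y = 1) (hs : ∀ x y, Q x y = Q y x) (t : ℕ)
    (x : X) {D : ℝ} (hD : ∀ z, tv ((Q ^ t) x) ((Q ^ t) z) ≤ D) :
    tv ((Q ^ t) x) (fun _ => 1 / (Fintype.card X : ℝ)) ≤ D := by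
  have hX : 0 < (Fintype.card X : ℝ) := by exact_mod_cast Fintype.card_pos
  have hcol : ∀ y, ∑ z, (Q ^ t) z y = 1 := fun y => by
    rw [← pow_row_sum h1 t y]; exact Finset.sum_congr rfl fun z _ => pow_symm hs t z y
  have hpt : ∀ y, |(Q ^ t) x y - 1 / (Fintype.card X : ℝ)| ≤
      1 / (Fintype.card X : ℝ) * ∑ z, |(Q ^ t) x y - (Q ^ t) z y| := by
    intro y
    -- The uniform law is the average of the rows, because the columns sum to 1.
    have : (Q ^ t) x y - 1 / (Fintype.card X : ℝ) =
        1 / (Fintype.card X : ℝ) * ∑ z, ((Q ^ t) x y - (Q ^ t) z y) := by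
      rw [Finset.sum_sub_distrib, hcol]
      simp
      field_simp
    rw [this, abs_mul, abs_of_pos (by positivity)]
    gcongr
    exact Finset.abs_sum_le_sum_abs _ _
  calc tv ((Q ^ t) x) (fun _ => 1 / (Fintype.card X : ℝ))
      ≤ 1 / 2 * ∑ y, 1 / (Fintype.card X : ℝ) * ∑ z, |(Q ^ t) x y - (Q ^ t) z y| := by
        unfold tv; gcongr with y; exact hpt y
    _ = 1 / (Fintype.card X : ℝ) * ∑ z, tv ((Q ^ t) x) ((Q ^ t) z) := by
        simp only [tv, ← Finset.mul_sum]
        rw [Finset.sum_comm]; ring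
    _ ≤ 1 / (Fintype.card X : ℝ) * ∑ _z : X, D := by gcongr with z; exact hD z
    _ = D := by simp

end Chain

/-! ### One-step expectations and the displacement eigenfunction. -/

theorem card_moves (hℓ : 1 ≤ ℓ) : ((moves ℓ).card : ℝ) = 2 * ((ℓ : ℝ) * (2 * ℓ - 1)) := by
  have h : ((ℓ : ℤ) - -(ℓ : ℤ) - 1).toNat = 2 * ℓ - 1 := by omega
  have h2 : ({1, -1} : Finset ℤ).card = 2 := by decide
  rw [moves, Finset.card_product, Finset.card_product, Int.card_Ioo, h, h2]
  rw [Finset.card_univ, Fintype.card_fin]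
  push_cast [Nat.cast_sub (show 1 ≤ 2 * ℓ by omega)]
  ring

theorem points_pos (hℓ : 1 ≤ ℓ) : 0 < (ℓ : ℝ) * (2 * ℓ - 1) := by
  have : (1 : ℝ) ≤ ℓ := by exact_mod_cast hℓ
  nlinarith

/-- Expected change, given a choice of the move. -/
theorem sum_rate_mul (h : Routing ℓ) (m : Fin ℓ × ℤ × ℤ) (f : Routing ℓ → ℝ) :
    ∑ g, rate h g m * f g = f h + 1 / ((tower h.1 m.1 m.2.1 m.2.2).card : ℝ) *
      (f (push h m.1 m.2.1 m.2.2) - f h) := by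
  simp only [rate, add_mul, Finset.sum_add_distrib, mul_assoc, ite_mul, one_mul, zero_mul,
    ← Finset.mul_sum, Finset.sum_ite_eq, Finset.mem_univ, if_true]
  ring

theorem sum_P_mul (hℓ : 1 ≤ ℓ) (h : Routing ℓ) (f : Routing ℓ → ℝ) :
    ∑ g, P ℓ h g * f g = f h + 1 / (2 * ((ℓ : ℝ) * (2 * ℓ - 1))) * ∑ m ∈ moves ℓ,
      1 / ((tower h.1 m.1 m.2.1 m.2.2).card : ℝ) * (f (push h m.1 m.2.1 m.2.2) - f h) := by
  have hN := points_pos hℓ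
  calc ∑ g, P ℓ h g * f g
      = 1 / ((ℓ : ℝ) * (2 * ℓ - 1)) * (1 / 2) * ∑ m ∈ moves ℓ, ∑ g, rate h g m * f g := by
        simp only [P_apply, mul_assoc, Finset.sum_mul, ← Finset.mul_sum]
        rw [Finset.sum_comm]
    _ = _ := by
        simp only [sum_rate_mul, Finset.sum_add_distrib, Finset.sum_const, nsmul_eq_mul,
          card_moves hℓ]
        generalize (ℓ : ℝ) * (2 * ℓ - 1) = N at hN
        field_simp

theorem P_row_sum (hℓ : 1 ≤ ℓ) (h : Routing ℓ) : ∑ g, P ℓ h g = 1 := by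
  simpa using sum_P_mul hℓ h (fun _ => 1)

theorem P_nonneg (hℓ : 1 ≤ ℓ) (h g : Routing ℓ) : 0 ≤ P ℓ h g := by
  have hN := points_pos hℓ
  rw [P_apply]
  refine mul_nonneg (by positivity) (Finset.sum_nonneg fun m _ => ?_)
  have : 1 / ((tower h.1 m.1 m.2.1 m.2.2).card : ℝ) ≤ 1 :=
    (div_le_one (by exact_mod_cast card_tower_pos _ _ _ _)).2
      (by exact_mod_cast card_tower_pos _ _ _ _)
  unfold rate
  refine add_nonneg (mul_nonneg (by positivity) (by split_ifs <;> norm_num))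
    (mul_nonneg (by linarith) (by split_ifs <;> norm_num))

/-- The weight of column `x`: the lowest mode of the discrete Laplacian on `[-ℓ, ℓ]`. -/
noncomputable def weight (ℓ : ℕ) (x : ℤ) : ℝ := Real.cos (Real.pi / (2 * ℓ) * x)

theorem weight_left (hℓ : 1 ≤ ℓ) : weight ℓ (-ℓ) = 0 := by
  have : (ℓ : ℝ) ≠ 0 := by positivity
  rw [weight, ← Real.cos_neg, ← Real.cos_pi_div_two]
  congr 1; push_cast; field_simp

theorem weight_right (hℓ : 1 ≤ ℓ) : weight ℓ ℓ = 0 := by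
  have : (ℓ : ℝ) ≠ 0 := by positivity
  rw [weight, ← Real.cos_pi_div_two]
  congr 1; push_cast; field_simp

theorem weight_add (x : ℤ) :
    weight ℓ (x - 1) + weight ℓ (x + 1) = 2 * Real.cos (Real.pi / (2 * ℓ)) * weight ℓ x := by
  simp only [weight]
  push_cast
  rw [mul_sub, mul_add, mul_one, Real.cos_sub, Real.cos_add]
  ring

/-- Wilson's statistic: the displacement of the paths, weighted by columns. -/
noncomputable def displacement (h : Routing ℓ) : ℝ :=
  ∑ i : Fin ℓ, ∑ x ∈ Finset.Ioo (-(ℓ : ℤ)) ℓ, ((h.1 i x : ℝ) - 2 * (i : ℕ)) * weight ℓ x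

theorem displacement_push (h : Routing ℓ) {m : Fin ℓ × ℤ × ℤ} (hm : m ∈ moves ℓ)
    [Decidable (IsRouting ℓ (shift h.1 m.1 m.2.1 m.2.2))] :
    displacement (push h m.1 m.2.1 m.2.2) - displacement h =
      if IsRouting ℓ (shift h.1 m.1 m.2.1 m.2.2) then
        2 * (m.2.2 : ℝ) * (tower h.1 m.1 m.2.1 m.2.2).card * weight ℓ m.2.1 else 0 := by
  obtain ⟨hx, -⟩ := mem_moves.1 hm
  split_ifs with H
  · rw [push_of_isRouting H]
    simp only [displacement, ← Finset.sum_sub_distrib]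
    have : ∀ i : Fin ℓ, ∀ x : ℤ, ((shift h.1 m.1 m.2.1 m.2.2 i x : ℝ) - 2 * (i : ℕ)) * weight ℓ x -
        ((h.1 i x : ℝ) - 2 * (i : ℕ)) * weight ℓ x = if x = m.2.1 then
          (if i ∈ tower h.1 m.1 m.2.1 m.2.2 then 2 * (m.2.2 : ℝ) * weight ℓ m.2.1 else 0) else 0 := by
      intro i x
      by_cases h1 : x = m.2.1
      · by_cases h2 : i ∈ tower h.1 m.1 m.2.1 m.2.2
        · rw [if_pos h1, if_pos h2, h1, shift_apply_of_mem h2]; push_cast; ring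
        · rw [if_pos h1, if_neg h2, shift_apply_of_notMem h2]; ring
      · rw [if_neg h1, shift_apply_of_ne h1]; ring
    simp only [this, Finset.sum_ite_eq', Finset.mem_Ioo, hx, and_self, if_true]
    rw [← Finset.sum_filter, Finset.sum_const, nsmul_eq_mul]
    simp
    ring
  · rw [push_of_not_isRouting H, sub_self]

/-- Summation by parts: the vanishing end values allow passing to half-open intervals, which are
translates of each other. -/
theorem sum_Ioo_shift {c g : ℤ → ℝ} (hc : c (-ℓ) = 0) (hg : g ℓ = 0) :
    ∑ x ∈ Finset.Ioo (-(ℓ : ℤ)) ℓ, c x * g (x + 1) =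
      ∑ x ∈ Finset.Ioo (-(ℓ : ℤ)) ℓ, c (x - 1) * g x := by
  have e1 : ∑ x ∈ Finset.Ioo (-(ℓ : ℤ)) ℓ, c x * g (x + 1) =
      ∑ x ∈ Finset.Ico (-(ℓ : ℤ)) ℓ, c x * g (x + 1) := by
    refine Finset.sum_subset Finset.Ioo_subset_Ico_self fun x hx hx' => ?_
    simp only [Finset.mem_Ico, Finset.mem_Ioo] at hx hx'
    rw [show x = -(ℓ : ℤ) by omega, hc, zero_mul]
  have e2 : ∑ x ∈ Finset.Ioo (-(ℓ : ℤ)) ℓ, c (x - 1) * g x =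
      ∑ x ∈ Finset.Ioc (-(ℓ : ℤ)) ℓ, c (x - 1) * g x := by
    refine Finset.sum_subset Finset.Ioo_subset_Ioc_self fun x hx hx' => ?_
    simp only [Finset.mem_Ioc, Finset.mem_Ioo] at hx hx'
    rw [show x = (ℓ : ℤ) by omega, hg, mul_zero]
  rw [e1, e2]
  refine Finset.sum_nbij' (· + 1) (· - 1) ?_ ?_ ?_ ?_ ?_ <;> intro x hx <;>
    simp only [Finset.mem_Ico, Finset.mem_Ioc] at hx ⊢
  · omega
  · omega
  · ring
  · ring
  · rw [add_sub_cancel_right]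

theorem sum_laplacian {c g : ℤ → ℝ} (hc : c (-ℓ) = 0) (hc' : c ℓ = 0)
    (hg : g (-ℓ) = 0) (hg' : g ℓ = 0) :
    ∑ x ∈ Finset.Ioo (-(ℓ : ℤ)) ℓ, c x * (g (x + 1) + g (x - 1)) =
      ∑ x ∈ Finset.Ioo (-(ℓ : ℤ)) ℓ, (c (x - 1) + c (x + 1)) * g x := by
  simp only [mul_add, add_mul, Finset.sum_add_distrib]
  rw [sum_Ioo_shift hc hg']
  congr 1
  have := sum_Ioo_shift hg hc'
  calc _ = ∑ x ∈ Finset.Ioo (-(ℓ : ℤ)) ℓ, g (x - 1) * c x :=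
        Finset.sum_congr rfl fun _ _ => mul_comm _ _
    _ = _ := by rw [← this]; exact Finset.sum_congr rfl fun _ _ => mul_comm _ _

/-- The factor 1/(k + 1) cancels the tower size, so path i contributes as if it were alone: ±2 at a
local extremum and 0 on a slope, which is exactly its discrete Laplacian. -/
theorem sum_sign_displacement (h : Routing ℓ) (i : Fin ℓ) {x : ℤ}
    (hx : x ∈ Finset.Ioo (-(ℓ : ℤ)) ℓ) :
    ∑ s ∈ ({1, -1} : Finset ℤ), 1 / ((tower h.1 i x s).card : ℝ) *
      (displacement (push h i x s) - displacement h) =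
      weight ℓ x * (((h.1 i (x + 1) : ℝ) - 2 * (i : ℕ)) + ((h.1 i (x - 1) : ℝ) - 2 * (i : ℕ))) -
        2 * (((h.1 i x : ℝ) - 2 * (i : ℕ)) * weight ℓ x) := by
  classical
  have hx' := Finset.mem_Ioo.1 hx
  have e : ∀ s : ℤ, s = 1 ∨ s = -1 → 1 / ((tower h.1 i x s).card : ℝ) *
      (displacement (push h i x s) - displacement h) =
      if h.1 i (x + 1) = h.1 i x + s ∧ h.1 i (x - 1) = h.1 i x + s then
        2 * (s : ℝ) * weight ℓ x else 0 := by
    intro s hs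
    have hc : ((tower h.1 i x s).card : ℝ) ≠ 0 := by exact_mod_cast (card_tower_pos _ _ _ _).ne'
    have := displacement_push h (m := (i, x, s)) (mem_moves.2 ⟨hx', hs⟩)
    simp only [h.2.shift_iff hx'.1 hx'.2 hs] at this
    rw [this]
    split_ifs
    · field_simp
    · simp
  rw [Finset.sum_pair (by norm_num), e 1 (Or.inl rfl), e (-1) (Or.inr rfl)]
  have a1 := h.2.step i x hx'.1.le hx'.2
  have a2 := h.2.step i (x - 1) (by omega) (by omega)
  rw [sub_add_cancel] at a2
  rw [abs_eq zero_le_one] at a1 a2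
  have b1 : h.1 i (x + 1) = h.1 i x + 1 ∨ h.1 i (x + 1) = h.1 i x + -1 := by omega
  have b2 : h.1 i (x - 1) = h.1 i x + 1 ∨ h.1 i (x - 1) = h.1 i x + -1 := by omega
  rcases b1 with b1 | b1 <;> rcases b2 with b2 | b2 <;> rw [b1, b2] <;> norm_num <;> ring

/-- The spectral gap of the lowest mode. -/
noncomputable def gap (ℓ : ℕ) : ℝ := (1 - Real.cos (Real.pi / (2 * ℓ))) / ((ℓ : ℝ) * (2 * ℓ - 1))

theorem sum_moves_displacement (hℓ : 1 ≤ ℓ) (h : Routing ℓ) :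
    1 / (2 * ((ℓ : ℝ) * (2 * ℓ - 1))) * ∑ m ∈ moves ℓ,
      1 / ((tower h.1 m.1 m.2.1 m.2.2).card : ℝ) *
        (displacement (push h m.1 m.2.1 m.2.2) - displacement h) = -gap ℓ * displacement h := by
  have hN := points_pos hℓ
  have e : ∑ m ∈ moves ℓ, 1 / ((tower h.1 m.1 m.2.1 m.2.2).card : ℝ) *
        (displacement (push h m.1 m.2.1 m.2.2) - displacement h) =
      -2 * (1 - Real.cos (Real.pi / (2 * ℓ))) * displacement h := by
    simp only [moves, Finset.sum_product]
    calc _ = ∑ i : Fin ℓ, ∑ x ∈ Finset.Ioo (-(ℓ : ℤ)) ℓ, (weight ℓ x *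
          (((h.1 i (x + 1) : ℝ) - 2 * (i : ℕ)) + ((h.1 i (x - 1) : ℝ) - 2 * (i : ℕ))) -
            2 * (((h.1 i x : ℝ) - 2 * (i : ℕ)) * weight ℓ x)) :=
          Finset.sum_congr rfl fun i _ => Finset.sum_congr rfl fun x hx =>
            sum_sign_displacement h i hx
      _ = _ := by
        rw [displacement, Finset.mul_sum]
        refine Finset.sum_congr rfl fun i _ => ?_
        have := sum_laplacian (c := weight ℓ) (g := fun x => (h.1 i x : ℝ) - 2 * (i : ℕ))
          (weight_left hℓ) (weight_right hℓ) (by rw [h.2.pinned i _ (by simp)]; simp)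
          (by rw [h.2.pinned i _ (by simp)]; simp)
        rw [Finset.sum_sub_distrib, this, ← Finset.sum_sub_distrib, Finset.mul_sum]
        refine Finset.sum_congr rfl fun x _ => ?_
        rw [weight_add]
        ring
  rw [e, gap]
  have h1 : (ℓ : ℝ) ≠ 0 := left_ne_zero_of_mul hN.ne'
  have h2 : (2 * (ℓ : ℝ) - 1) ≠ 0 := right_ne_zero_of_mul hN.ne'
  field_simp

theorem P_mulVec_displacement (hℓ : 1 ≤ ℓ) :
    P ℓ *ᵥ displacement = (1 - gap ℓ) • (displacement : Routing ℓ → ℝ) := by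
  funext h
  have := sum_P_mul hℓ h displacement
  rw [sum_moves_displacement hℓ] at this
  simp only [mulVec, dotProduct, Pi.smul_apply, smul_eq_mul]
  rw [this]
  ring

/-- A jump of 2(k + 1) times the weight, taken with probability 1/(k + 1), has second moment linear
in the tower size, which is at most ℓ. -/
theorem displacement_sq_increment_le (h : Routing ℓ) {m : Fin ℓ × ℤ × ℤ} (hm : m ∈ moves ℓ) :
    1 / ((tower h.1 m.1 m.2.1 m.2.2).card : ℝ) *
      (displacement (push h m.1 m.2.1 m.2.2) - displacement h) ^ 2 ≤ 4 * ℓ := by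
  classical
  rw [displacement_push h hm]
  split_ifs
  · have hc : (0 : ℝ) < (tower h.1 m.1 m.2.1 m.2.2).card := by
      exact_mod_cast card_tower_pos _ _ _ _
    have hc' : ((tower h.1 m.1 m.2.1 m.2.2).card : ℝ) ≤ ℓ := by exact_mod_cast card_tower_le _ _ _ _
    have hs : (m.2.2 : ℝ) ^ 2 = 1 := by
      rcases (mem_moves.1 hm).2 with h | h <;> rw [h] <;> norm_num
    have hw : weight ℓ m.2.1 ^ 2 ≤ 1 := Real.cos_sq_le_one _
    calc _ = 4 * (m.2.2 : ℝ) ^ 2 * ((tower h.1 m.1 m.2.1 m.2.2).card * weight ℓ m.2.1 ^ 2) := by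
          field_simp; ring
      _ = 4 * ((tower h.1 m.1 m.2.1 m.2.2).card * weight ℓ m.2.1 ^ 2) := by rw [hs, mul_one]
      _ ≤ 4 * (ℓ * 1) := by gcongr
      _ = _ := by ring
  · simp

theorem sum_P_displacement_sq_le (hℓ : 1 ≤ ℓ) (h : Routing ℓ) :
    ∑ g, P ℓ h g * displacement g ^ 2 ≤ (1 - 2 * gap ℓ) * displacement h ^ 2 + 4 * ℓ := by
  have hN := points_pos hℓ
  rw [sum_P_mul hℓ h (fun g => displacement g ^ 2)]
  have e : ∑ m ∈ moves ℓ, 1 / ((tower h.1 m.1 m.2.1 m.2.2).card : ℝ) *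
      (displacement (push h m.1 m.2.1 m.2.2) ^ 2 - displacement h ^ 2) =
      2 * displacement h * ∑ m ∈ moves ℓ, 1 / ((tower h.1 m.1 m.2.1 m.2.2).card : ℝ) *
        (displacement (push h m.1 m.2.1 m.2.2) - displacement h) +
      ∑ m ∈ moves ℓ, 1 / ((tower h.1 m.1 m.2.1 m.2.2).card : ℝ) *
        (displacement (push h m.1 m.2.1 m.2.2) - displacement h) ^ 2 := by
    rw [Finset.mul_sum, ← Finset.sum_add_distrib]
    exact Finset.sum_congr rfl fun _ _ => by ring
  have b : ∑ m ∈ moves ℓ, 1 / ((tower h.1 m.1 m.2.1 m.2.2).card : ℝ) *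
        (displacement (push h m.1 m.2.1 m.2.2) - displacement h) ^ 2 ≤
      2 * ((ℓ : ℝ) * (2 * ℓ - 1)) * (4 * ℓ) := by
    rw [← card_moves hℓ, ← nsmul_eq_mul]
    exact Finset.sum_le_card_nsmul _ _ _ fun m hm => displacement_sq_increment_le h hm
  have b' : 1 / (2 * ((ℓ : ℝ) * (2 * ℓ - 1))) * ∑ m ∈ moves ℓ,
      1 / ((tower h.1 m.1 m.2.1 m.2.2).card : ℝ) *
        (displacement (push h m.1 m.2.1 m.2.2) - displacement h) ^ 2 ≤ 4 * ℓ := by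
    rw [one_div, inv_mul_le_iff₀ (by positivity)]
    exact b
  have d := sum_moves_displacement hℓ h
  simp only [e, mul_add]
  rw [mul_left_comm, d]
  linarith

/-! ### Estimates for the starting state and the gap. -/

/-- The family of the highest paths. -/
def top (ℓ : ℕ) : Routing ℓ :=
  ⟨fun i x => 2 * (i : ℤ) + max 0 (ℓ - |x|), by
    refine ⟨fun i x hx => ?_, fun i x hx hx' => ?_, fun i j hij x => ?_⟩
    · have : (ℓ : ℤ) ≤ |x| := by rcases hx with hx | hx <;> rw [le_abs] <;> omega
      rw [max_eq_left (by omega), add_zero]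
    · rcases lt_or_ge x 0 with h | h
      · rw [abs_of_neg h, abs_of_nonpos (by omega : x + 1 ≤ 0), max_eq_right (by omega),
          max_eq_right (by omega)]
        ring_nf; simp
      · rw [abs_of_nonneg h, abs_of_nonneg (by omega : 0 ≤ x + 1), max_eq_right (by omega),
          max_eq_right (by omega)]
        ring_nf; simp
    · have : (i : ℤ) < j := by exact_mod_cast hij
      omega⟩

theorem weight_nonneg {x : ℤ} (hx : |x| ≤ ℓ) : 0 ≤ weight ℓ x := by
  rcases Nat.eq_zero_or_pos ℓ with rfl | hℓ
  · simp [weight]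
  have hl : (0 : ℝ) < ℓ := by exact_mod_cast hℓ
  have hx' : |(x : ℝ)| ≤ ℓ := by exact_mod_cast hx
  have hb := abs_le.1 hx'
  have e : Real.pi / 2 = Real.pi / (2 * ℓ) * ℓ := by field_simp
  have hp : 0 < Real.pi / (2 * ℓ) := by positivity
  refine Real.cos_nonneg_of_neg_pi_div_two_le_of_le ?_ ?_
  · rw [e]; nlinarith
  · rw [e]; nlinarith

theorem half_le_weight {x : ℤ} (hx : 2 * |x| ≤ ℓ) : 1 / 2 ≤ weight ℓ x := by
  rcases Nat.eq_zero_or_pos ℓ with rfl | hℓ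
  · simp [weight]; norm_num
  have hl : (0 : ℝ) < ℓ := by exact_mod_cast hℓ
  have hx' : 2 * |(x : ℝ)| ≤ ℓ := by exact_mod_cast hx
  rw [weight, ← Real.cos_abs, ← Real.cos_pi_div_three, abs_mul, abs_of_pos (by positivity)]
  refine Real.cos_le_cos_of_nonneg_of_le_pi (by positivity) (by linarith [Real.pi_pos]) ?_
  have hp := Real.pi_pos
  calc Real.pi / (2 * ℓ) * |(x : ℝ)| ≤ Real.pi / (2 * ℓ) * (ℓ / 2) := by gcongr; linarith
    _ = Real.pi / 4 := by field_simp; norm_num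
    _ ≤ _ := by linarith

/-- Only the central columns |x| ≤ ℓ/2 are kept: at least ℓ/2 of them, each with height at least ℓ/2
and weight at least 1/2, for each of ℓ paths. -/
theorem le_displacement_top (hℓ : 2 ≤ ℓ) : (ℓ : ℝ) ^ 3 / 8 ≤ displacement (top ℓ) := by
  have key : (ℓ : ℝ) ^ 2 / 8 ≤
      ∑ x ∈ Finset.Ioo (-(ℓ : ℤ)) ℓ, ((max 0 ((ℓ : ℤ) - |x|) : ℤ) : ℝ) * weight ℓ x := by
    have hsub : Finset.Icc (-((ℓ / 2 : ℕ) : ℤ)) ((ℓ / 2 : ℕ) : ℤ) ⊆ Finset.Ioo (-(ℓ : ℤ)) ℓ := by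
      intro x hx
      rw [Finset.mem_Icc] at hx
      rw [Finset.mem_Ioo]
      omega
    have hcard : (ℓ : ℝ) / 2 ≤ (Finset.Icc (-((ℓ / 2 : ℕ) : ℤ)) ((ℓ / 2 : ℕ) : ℤ)).card := by
      rw [Int.card_Icc, div_le_iff₀ two_pos]
      have : ℓ ≤ (((ℓ / 2 : ℕ) : ℤ) + 1 - -((ℓ / 2 : ℕ) : ℤ)).toNat * 2 := by omega
      exact_mod_cast this
    calc (ℓ : ℝ) ^ 2 / 8 = (ℓ : ℝ) / 2 * (ℓ / 4) := by ring
      _ ≤ (Finset.Icc (-((ℓ / 2 : ℕ) : ℤ)) ((ℓ / 2 : ℕ) : ℤ)).card * (ℓ / 4 : ℝ) := by gcongr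
      _ ≤ ∑ x ∈ Finset.Icc (-((ℓ / 2 : ℕ) : ℤ)) ((ℓ / 2 : ℕ) : ℤ),
            ((max 0 ((ℓ : ℤ) - |x|) : ℤ) : ℝ) * weight ℓ x := by
          rw [← nsmul_eq_mul]
          refine Finset.card_nsmul_le_sum _ _ _ fun x hx => ?_
          have hx' : 2 * |x| ≤ ℓ := by
            rw [Finset.mem_Icc, ← abs_le] at hx
            omega
          have h1 : (ℓ : ℝ) / 2 ≤ ((max 0 ((ℓ : ℤ) - |x|) : ℤ) : ℝ) := by
            rw [div_le_iff₀ two_pos]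
            have : (ℓ : ℤ) ≤ max 0 ((ℓ : ℤ) - |x|) * 2 := by omega
            exact_mod_cast this
          calc (ℓ : ℝ) / 4 = ℓ / 2 * (1 / 2) := by ring
            _ ≤ _ := mul_le_mul h1 (half_le_weight hx') (by norm_num) (le_trans (by positivity) h1)
      _ ≤ _ := by
          refine Finset.sum_le_sum_of_subset_of_nonneg hsub fun x hx _ => ?_
          rw [Finset.mem_Ioo] at hx
          exact mul_nonneg (by exact_mod_cast le_max_left _ _)
            (weight_nonneg (abs_le.2 ⟨hx.1.le, hx.2.le⟩))
  have e : displacement (top ℓ) = ℓ *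
      ∑ x ∈ Finset.Ioo (-(ℓ : ℤ)) ℓ, ((max 0 ((ℓ : ℤ) - |x|) : ℤ) : ℝ) * weight ℓ x := by
    simp [displacement, top]
  rw [e]
  calc (ℓ : ℝ) ^ 3 / 8 = ℓ * (ℓ ^ 2 / 8) := by ring
    _ ≤ _ := by gcongr

/-- A crude bound suffices here: it enters only through the variance, hence only the additive
`loss`. -/
theorem le_gap (hℓ : 1 ≤ ℓ) : 1 / (4 * (ℓ : ℝ) ^ 4) ≤ gap ℓ := by
  have hN := points_pos hℓ
  have hl : (0 : ℝ) < ℓ := by exact_mod_cast hℓ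
  have hp := Real.pi_pos
  have habs : |Real.pi / (2 * ℓ)| ≤ Real.pi := by
    have h1 : (1 : ℝ) ≤ ℓ := by exact_mod_cast hℓ
    rw [abs_of_pos (by positivity)]
    exact div_le_self hp.le (by linarith)
  have hc : 1 / (2 * (ℓ : ℝ) ^ 2) ≤ 1 - Real.cos (Real.pi / (2 * ℓ)) := by
    have := Real.cos_le_one_sub_mul_cos_sq habs
    have e : 2 / Real.pi ^ 2 * (Real.pi / (2 * ℓ)) ^ 2 = 1 / (2 * (ℓ : ℝ) ^ 2) := by field_simp
    linarith
  rw [gap, le_div_iff₀ hN]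
  refine le_trans ?_ hc
  calc 1 / (4 * (ℓ : ℝ) ^ 4) * (ℓ * (2 * ℓ - 1)) ≤ 1 / (4 * (ℓ : ℝ) ^ 4) * (ℓ * (2 * ℓ)) := by
        gcongr; linarith
    _ = _ := by field_simp; norm_num

/-- The sharp side, from 1 - cos u ≤ u²/2; it produces the leading constant 8/π². -/
theorem gap_le (hℓ : 1 ≤ ℓ) :
    gap ℓ * (8 * (ℓ : ℝ) ^ 3 * (2 * ℓ - 1)) ≤ Real.pi ^ 2 := by
  have hN := points_pos hℓ
  have hl : (0 : ℝ) < ℓ := by exact_mod_cast hℓ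
  have h2 : 0 < 2 * (ℓ : ℝ) - 1 := pos_of_mul_pos_right hN hl.le
  have := Real.one_sub_sq_div_two_le_cos (x := Real.pi / (2 * ℓ))
  have e : gap ℓ * (8 * (ℓ : ℝ) ^ 3 * (2 * ℓ - 1)) =
      (1 - Real.cos (Real.pi / (2 * ℓ))) * (8 * (ℓ : ℝ) ^ 2) := by
    rw [gap]; field_simp
  rw [e]
  calc _ ≤ (Real.pi / (2 * ℓ)) ^ 2 / 2 * (8 * (ℓ : ℝ) ^ 2) := by gcongr; linarith
    _ = _ := by field_simp; norm_num

theorem two_mul_gap_le (hℓ : 2 ≤ ℓ) : 2 * gap ℓ ≤ 1 := by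
  have hl : (2 : ℝ) ≤ ℓ := by exact_mod_cast hℓ
  have h6 : (2 : ℝ) ≤ ℓ * (2 * ℓ - 1) := by nlinarith
  have hc : 0 ≤ Real.cos (Real.pi / (2 * ℓ)) := by
    have hp := Real.pi_pos
    refine Real.cos_nonneg_of_neg_pi_div_two_le_of_le
      (by have : 0 < Real.pi / (2 * ℓ) := by positivity
          linarith) ?_
    gcongr; linarith
  rw [gap, mul_div_assoc', div_le_one (by linarith)]
  linarith

/-! ### The explicit lower bound and its asymptotics. -/

/-- The additive constant that the accuracy `ε` costs in the exponent. -/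
noncomputable def loss (ε : ℝ) : ℝ := Real.log (2048 / (1 - ε)) / 2

theorem le_d {ε : ℝ} (hε : ε < 1) (hℓ : 2 ≤ ℓ) {t : ℕ}
    (ht : t * gap ℓ ≤ (1 - gap ℓ) * (Real.log ℓ / 2 - loss ε)) : ε ≤ d ℓ t := by
  have hℓ1 : 1 ≤ ℓ := by omega
  have hl : (0 : ℝ) < ℓ := by exact_mod_cast hℓ1
  have hg : 0 < gap ℓ := lt_of_lt_of_le (by positivity) (le_gap hℓ1)
  have hg2 := two_mul_gap_le hℓ
  have hg1 : 0 < 1 - gap ℓ := by linarith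
  have hε1 : 0 < 1 - ε := by linarith
  have hΦ := le_displacement_top hℓ
  have hΦ0 : 0 < displacement (top ℓ) := lt_of_lt_of_le (by positivity) hΦ
  refine le_trans ?_ ((one_sub_le_tv_uniform (P_nonneg hℓ1) (P_row_sum hℓ1) P_symm hg hg2
    (by positivity) (P_mulVec_displacement hℓ1) (sum_P_displacement_sq_le hℓ1) t (top ℓ)
    hΦ0.ne').trans (le_ciSup (f := fun g : Routing ℓ => tv ((P ℓ ^ t) g)
      (fun _ => 1 / (Fintype.card (Routing ℓ) : ℝ))) (Set.finite_range _).bddAbove (top ℓ)))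
  have hexp : Real.exp (-(Real.log ℓ / 2 - loss ε)) ≤ (1 - gap ℓ) ^ t := by
    -- This is 1 + u ≤ exp u at u = γ/(1 - γ), inverted; it is the source of the factor 1 - γ in
    -- `ht`.
    have h1 : Real.exp (-(gap ℓ / (1 - gap ℓ))) ≤ 1 - gap ℓ := by
      rw [Real.exp_neg, inv_le_comm₀ (Real.exp_pos _) hg1]
      calc (1 - gap ℓ)⁻¹ = gap ℓ / (1 - gap ℓ) + 1 := by field_simp; ring
        _ ≤ _ := Real.add_one_le_exp _
    refine le_trans ?_ (pow_le_pow_left₀ (Real.exp_pos _).le h1 t)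
    rw [← Real.exp_nat_mul, Real.exp_le_exp, mul_neg, neg_le_neg_iff, mul_div_assoc',
      div_le_iff₀ hg1]
    linarith
  have hsq : 2048 / (1 - ε) / ℓ ≤ ((1 - gap ℓ) ^ t) ^ 2 := by
    refine le_trans (le_of_eq ?_) (pow_le_pow_left₀ (Real.exp_pos _).le hexp 2)
    rw [← Real.exp_nat_mul, loss]
    have : ((2 : ℕ) : ℝ) * -(Real.log ℓ / 2 - Real.log (2048 / (1 - ε)) / 2) =
        Real.log (2048 / (1 - ε)) - Real.log ℓ := by push_cast; ring
    rw [this, Real.exp_sub, Real.exp_log (by positivity), Real.exp_log hl]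
  -- The constant 2048 = 8 · 4 · 64 collects 2R = 8ℓ, the gap bound 1/(4ℓ⁴) and the squared start
  -- ℓ⁶/64.
  have hbig : 8 * ℓ / (1 - ε) ≤ gap ℓ * ((1 - gap ℓ) ^ t * displacement (top ℓ)) ^ 2 := by
    calc 8 * ℓ / (1 - ε) = 1 / (4 * (ℓ : ℝ) ^ 4) * (2048 / (1 - ε) / ℓ * ((ℓ : ℝ) ^ 3 / 8) ^ 2) := by
          field_simp; norm_num
      _ ≤ gap ℓ * (((1 - gap ℓ) ^ t) ^ 2 * displacement (top ℓ) ^ 2) := by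
          gcongr
          exact le_gap hℓ1
      _ = _ := by ring
  have : 2 * (4 * ℓ) / (gap ℓ * ((1 - gap ℓ) ^ t * displacement (top ℓ)) ^ 2) ≤ 1 - ε := by
    rw [div_le_iff₀ (by positivity)]
    rw [div_le_iff₀ hε1] at hbig
    linarith
  linarith

theorem d_le_dbar (hℓ : 1 ≤ ℓ) (t : ℕ) : d ℓ t ≤ dbar ℓ t := by
  have : Nonempty (Routing ℓ) := ⟨top ℓ⟩
  exact ciSup_le fun g => tv_uniform_le (P_row_sum hℓ) P_symm t g fun z =>
    le_ciSup (f := fun g : Routing ℓ × Routing ℓ => tv ((P ℓ ^ t) g.1) ((P ℓ ^ t) g.2))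
      (Set.finite_range _).bddAbove (g, z)

/-- The explicit lower bound for the mixing time. -/
noncomputable def lowerBound (ε : ℝ) (ℓ : ℕ) : ℝ :=
  (8 * (ℓ : ℝ) ^ 3 * (2 * ℓ - 1) / Real.pi ^ 2 - 1) * (Real.log ℓ / 2 - loss ε)

theorem lowerBound_le_of_d_lt {ε : ℝ} (hε : ε < 1) (hℓ : 2 ≤ ℓ) {t : ℕ} (ht : d ℓ t < ε) :
    lowerBound ε ℓ ≤ t := by
  have hℓ1 : 1 ≤ ℓ := by omega
  have hl : (2 : ℝ) ≤ ℓ := by exact_mod_cast hℓ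
  have hg : 0 < gap ℓ := lt_of_lt_of_le (by positivity) (le_gap hℓ1)
  have hp := Real.pi_pos
  have h1 : (1 - gap ℓ) * (Real.log ℓ / 2 - loss ε) < t * gap ℓ := by
    by_contra! h
    exact absurd (le_d hε hℓ h) (not_le.2 ht)
  unfold lowerBound
  -- For small ℓ the second factor may be negative; then the bound is nonpositive and holds
  -- trivially.
  rcases le_total (Real.log ℓ / 2 - loss ε) 0 with h0 | h0
  · refine le_trans (mul_nonpos_of_nonneg_of_nonpos ?_ h0) (Nat.cast_nonneg t)
    rw [sub_nonneg, one_le_div (by positivity)]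
    have h3 : (8 : ℝ) ≤ ℓ ^ 3 := by
      calc (8 : ℝ) = 2 ^ 3 := by norm_num
        _ ≤ _ := by gcongr
    nlinarith [Real.pi_le_four]
  · have h2 : 8 * (ℓ : ℝ) ^ 3 * (2 * ℓ - 1) / Real.pi ^ 2 ≤ 1 / gap ℓ := by
      rw [div_le_div_iff₀ (by positivity) hg]
      linarith [gap_le hℓ1]
    calc _ ≤ (1 / gap ℓ - 1) * (Real.log ℓ / 2 - loss ε) := by gcongr
      _ = (1 - gap ℓ) * (Real.log ℓ / 2 - loss ε) / gap ℓ := by field_simp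
      _ ≤ _ := by rw [div_le_iff₀ hg]; exact h1.le

theorem le_firstTimeBelow {f : ℕ → ℝ} {ε B : ℝ} (h : ∀ t, f t < ε → B ≤ t) :
    (B : EReal) ≤ ((firstTimeBelow f ε : ENNReal) : EReal) := by
  have h1 : ((⌈B⌉₊ : ℕ) : ℕ∞) ≤ firstTimeBelow f ε :=
    le_iInf₂ fun t ht => by exact_mod_cast Nat.ceil_le.2 (h t ht)
  have h2 : ((⌈B⌉₊ : ℕ) : ENNReal) ≤ (firstTimeBelow f ε : ENNReal) := by
    exact_mod_cast ENat.toENNReal_le.2 h1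
  calc (B : EReal) ≤ ((⌈B⌉₊ : ℝ) : EReal) := EReal.coe_le_coe_iff.2 (Nat.le_ceil B)
    _ = (((⌈B⌉₊ : ℕ) : ENNReal) : EReal) := by
        rw [← ENNReal.coe_natCast, EReal.coe_nnreal_eq_coe_real, NNReal.coe_natCast]
    _ ≤ _ := EReal.coe_ennreal_le_coe_ennreal_iff.2 h2

theorem tendsto_lowerBound (ε : ℝ) :
    Tendsto (fun ℓ : ℕ => lowerBound ε ℓ / ((ℓ : ℝ) ^ 4 * Real.log ℓ)) atTop
      (𝓝 (8 / Real.pi ^ 2)) := by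
  have hinv : Tendsto (fun ℓ : ℕ => ((ℓ : ℝ))⁻¹) atTop (𝓝 0) := tendsto_inv_atTop_nhds_zero_nat
  have hlog : Tendsto (fun ℓ : ℕ => (Real.log ℓ)⁻¹) atTop (𝓝 0) :=
    (Real.tendsto_log_atTop.comp tendsto_natCast_atTop_atTop).inv_tendsto_atTop
  have hlim : Tendsto (fun ℓ : ℕ => (8 / Real.pi ^ 2 * (2 - (ℓ : ℝ)⁻¹) - (ℓ : ℝ)⁻¹ ^ 4) *
      (1 / 2 - loss ε * (Real.log ℓ)⁻¹)) atTop
      (𝓝 ((8 / Real.pi ^ 2 * (2 - 0) - 0 ^ 4) * (1 / 2 - loss ε * 0))) :=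
    (((hinv.const_sub 2).const_mul _).sub (hinv.pow 4)).mul ((hlog.const_mul _).const_sub _)
  have hval : (8 / Real.pi ^ 2 * (2 - 0) - 0 ^ 4) * (1 / 2 - loss ε * 0) = 8 / Real.pi ^ 2 := by
    ring
  rw [hval] at hlim
  refine hlim.congr' ?_
  filter_upwards [eventually_ge_atTop 2] with ℓ hℓ
  have hl : (1 : ℝ) < ℓ := by exact_mod_cast hℓ
  have h0 : (ℓ : ℝ) ≠ 0 := by linarith
  have h1 : Real.log ℓ ≠ 0 := (Real.log_pos hl).ne'
  unfold lowerBound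
  field_simp

end LRS

theorem theorem5p2 (ε : ℝ) (hε : 0 < ε) (hε' : ε < 1) :
    ∃ o : ℕ → ℝ, Tendsto o atTop (𝓝 0) ∧ ∀ ℓ : ℕ, 1 ≤ ℓ →
      (((8 / Real.pi ^ 2 - o ℓ) * (ℓ : ℝ) ^ 4 * Real.log ℓ : ℝ) : EReal) ≤
          ((LRS.mixingTime ℓ ε : ENNReal) : EReal) ∧
      (((8 / Real.pi ^ 2 - o ℓ) * (ℓ : ℝ) ^ 4 * Real.log ℓ : ℝ) : EReal) ≤
          ((LRS.firstTimeBelow (LRS.d ℓ) ε : ENNReal) : EReal) := by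
  -- The error term is chosen so that the claimed bound equals `lowerBound` whenever ℓ ≥ 2.
  refine ⟨fun ℓ => 8 / Real.pi ^ 2 - LRS.lowerBound ε ℓ / ((ℓ : ℝ) ^ 4 * Real.log ℓ), ?_, ?_⟩
  · have := (LRS.tendsto_lowerBound ε).const_sub (8 / Real.pi ^ 2)
    rwa [sub_self] at this
  intro ℓ hℓ
  have key : ∀ t : ℕ, LRS.d ℓ t < ε → (8 / Real.pi ^ 2 - (8 / Real.pi ^ 2 -
      LRS.lowerBound ε ℓ / ((ℓ : ℝ) ^ 4 * Real.log ℓ))) * (ℓ : ℝ) ^ 4 * Real.log ℓ ≤ t := by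
    intro t ht
    -- For ℓ = 1 the claimed bound is 0, since log 1 = 0.
    rcases Nat.eq_or_lt_of_le hℓ with rfl | hℓ2
    · simp
    · have hl : (1 : ℝ) < ℓ := by exact_mod_cast hℓ2
      have h0 : (ℓ : ℝ) ≠ 0 := by linarith
      have h1 : Real.log ℓ ≠ 0 := (Real.log_pos hl).ne'
      refine le_trans (le_of_eq ?_) (LRS.lowerBound_le_of_d_lt hε' hℓ2 ht)
      field_simp
      ring
  exact ⟨LRS.le_firstTimeBelow fun t ht => key t ((LRS.d_le_dbar hℓ t).trans_lt ht),
    LRS.le_firstTimeBelow key⟩
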